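/- All graphs are finite and simple. For a natural number $k$, a graph $G$ is $k$-vertex-critical if its chromatic number satisfies $\chi(G)=k$ and $\chi(G-v)<k$ for every vertex $v$ of $G$. For graphs $H_1,H_2$, a graph is $(H_1,H_2)$-free if none of its induced subgraphs is isomorphic to $H_1$ or to $H_2$. The co-gem is the disjoint union $P_4+P_1$ of a path on four vertices and a single vertex; the paw is the graph on four vertices consisting of a triangle and a fourth vertex adjacent to exactly one vertex of the triangle; and $\text{paw}+P_1$ is the disjoint union of the paw and a single vertex. **Theorem 4.1.** For every $k$ there are, up to isomorphism, only finitely many $k$-vertex-critical $(\text{co-gem},\ \text{paw}+P_1)$-free graphs. -/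

import Mathlib

/-- `G` is `k`-vertex-critical: its chromatic number is `k`, and deleting any single vertex gives
a graph of chromatic number smaller than `k`. -/
def IsVertexCritical {V : Type*} (G : SimpleGraph V) (k : ℕ) : Prop :=
  G.chromaticNumber = (k : ℕ∞) ∧
    ∀ v : V, (G.induce ({v}ᶜ : Set V)).chromaticNumber < (k : ℕ∞)

/-- `G` is `H`-free: no induced subgraph of `G` is isomorphic to `H`. -/
def IsIndFree {V W : Type*} (H : SimpleGraph W) (G : SimpleGraph V) : Prop :=
  ¬ SimpleGraph.IsIndContained H G

/-- The co-gem, that is, the disjoint union of a path on four vertices and a single vertex. -/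
def coGem : SimpleGraph (Fin 4 ⊕ Fin 1) :=
  SimpleGraph.pathGraph 4 ⊕g SimpleGraph.pathGraph 1

/-- The paw: the triangle `0, 1, 2` together with the vertex `3`, which is adjacent to `2` only. -/
def paw : SimpleGraph (Fin 4) :=
  SimpleGraph.fromEdgeSet {s(0, 1), s(1, 2), s(0, 2), s(2, 3)}

/-- The disjoint union of the paw and a single vertex. -/
def pawPlusPoint : SimpleGraph (Fin 4 ⊕ Fin 1) :=
  paw ⊕g SimpleGraph.pathGraph 1

/-! A `k`-colourable graph has at most `k` times as many vertices as its largest independent set, so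
it suffices to bound a maximal independent set `S`. Call the neighbours of a vertex in `S` its
trace. A vertex of `S` missed by two outside vertices serves as the isolated vertex of a co-gem or
paw + `P₁`, which makes their traces equal or disjoint. If no outside vertex misses two vertices of
`S`, a large `S` permits a recolouring. Otherwise criticality forces every outside trace to be all
of `S` or a single vertex. Removing the vertices `F` complete to `S` then separates the vertices of
`S`, each with its private neighbours, and every such piece is complete to `F`; exchanging
colourings between two pieces contradicts criticality. -/

section ForbiddenPatterns

variable {V : Type*} {G : SimpleGraph V}

/-- In a co-gem-free graph every induced path on four vertices is dominating. -/
lemma IsIndFree.not_coGem (h : IsIndFree coGem G) {a b c d e : V}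
    (hab : G.Adj a b) (hbc : G.Adj b c) (hcd : G.Adj c d)
    (hac : ¬ G.Adj a c) (had : ¬ G.Adj a d) (hbd : ¬ G.Adj b d)
    (hae : ¬ G.Adj a e) (hbe : ¬ G.Adj b e) (hce : ¬ G.Adj c e) (hde : ¬ G.Adj d e) : False := by
  have hba := hab.symm
  have hcb := hbc.symm
  have hdc := hcd.symm
  have hca : ¬ G.Adj c a := fun h => hac h.symm
  have hda : ¬ G.Adj d a := fun h => had h.symm
  have hdb : ¬ G.Adj d b := fun h => hbd h.symm
  have hea : ¬ G.Adj e a := fun h => hae h.symm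
  have heb : ¬ G.Adj e b := fun h => hbe h.symm
  have hec : ¬ G.Adj e c := fun h => hce h.symm
  have hed : ¬ G.Adj e d := fun h => hde h.symm
  have n1 : a ≠ b := hab.ne
  have n2 : a ≠ c := by rintro rfl; exact had hcd
  have n3 : a ≠ d := by rintro rfl; exact hca hcd
  have n4 : a ≠ e := by rintro rfl; exact hbe hba
  have n5 : b ≠ c := hbc.ne
  have n6 : b ≠ d := by rintro rfl; exact had hab
  have n7 : b ≠ e := by rintro rfl; exact hae hab
  have n8 : c ≠ d := hcd.ne
  have n9 : c ≠ e := by rintro rfl; exact hbe hbc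
  have n10 : d ≠ e := by rintro rfl; exact hce hcd
  apply h
  refine ⟨⟨⟨Sum.elim ![a, b, c, d] ![e], ?_⟩, ?_⟩⟩
  · rintro (i | i) (j | j) hij <;> fin_cases i <;> fin_cases j <;> simp_all
  · intro i j
    change G.Adj (Sum.elim ![a, b, c, d] ![e] i) (Sum.elim ![a, b, c, d] ![e] j) ↔ _
    rcases i with i | i <;> rcases j with j | j <;> fin_cases i <;> fin_cases j <;>
      simp [*, coGem, SimpleGraph.pathGraph_adj]

/-- In a `paw + P₁`-free graph every induced paw is dominating. -/
lemma IsIndFree.not_pawPlusPoint (h : IsIndFree pawPlusPoint G) {a b c d e : V}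
    (hab : G.Adj a b) (hbc : G.Adj b c) (hac : G.Adj a c) (hcd : G.Adj c d)
    (had : ¬ G.Adj a d) (hbd : ¬ G.Adj b d)
    (hae : ¬ G.Adj a e) (hbe : ¬ G.Adj b e) (hce : ¬ G.Adj c e) (hde : ¬ G.Adj d e) : False := by
  have hba := hab.symm
  have hcb := hbc.symm
  have hdc := hcd.symm
  have hca := hac.symm
  have hda : ¬ G.Adj d a := fun h => had h.symm
  have hdb : ¬ G.Adj d b := fun h => hbd h.symm
  have hea : ¬ G.Adj e a := fun h => hae h.symm
  have heb : ¬ G.Adj e b := fun h => hbe h.symm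
  have hec : ¬ G.Adj e c := fun h => hce h.symm
  have hed : ¬ G.Adj e d := fun h => hde h.symm
  have n1 : a ≠ b := hab.ne
  have n2 : a ≠ c := hac.ne
  have n3 : a ≠ d := by rintro rfl; exact hbd hba
  have n4 : a ≠ e := by rintro rfl; exact hbe hba
  have n5 : b ≠ c := hbc.ne
  have n6 : b ≠ d := by rintro rfl; exact had hab
  have n7 : b ≠ e := by rintro rfl; exact hae hab
  have n8 : c ≠ d := hcd.ne
  have n9 : c ≠ e := by rintro rfl; exact hbe hbc
  have n10 : d ≠ e := by rintro rfl; exact hce hcd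
  apply h
  refine ⟨⟨⟨Sum.elim ![a, b, c, d] ![e], ?_⟩, ?_⟩⟩
  · rintro (i | i) (j | j) hij <;> fin_cases i <;> fin_cases j <;> simp_all
  · intro i j
    change G.Adj (Sum.elim ![a, b, c, d] ![e] i) (Sum.elim ![a, b, c, d] ![e] j) ↔ _
    rcases i with i | i <;> rcases j with j | j <;> fin_cases i <;> fin_cases j <;>
      simp [*, pawPlusPoint, paw]

/-- Two vertices missing a common vertex of an independent set `S` have equal or disjoint traces
on `S`. -/
lemma trace_subset_of_common (h₁ : IsIndFree coGem G) (h₂ : IsIndFree pawPlusPoint G)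
    {S : Finset V} (hS : ∀ a ∈ S, ∀ b ∈ S, ¬ G.Adj a b) {x y s a b : V}
    (hs : s ∈ S) (ha : a ∈ S) (hb : b ∈ S) (hxs : ¬ G.Adj x s) (hys : ¬ G.Adj y s)
    (hxa : G.Adj x a) (hya : G.Adj y a) (hxb : G.Adj x b) : G.Adj y b := by
  by_contra hyb
  by_cases hxy : G.Adj x y
  · exact h₂.not_pawPlusPoint hya.symm hxy.symm hxa.symm hxb (hS a ha b hb) hyb
      (hS a ha s hs) hys hxs (hS b hb s hs)
  · exact h₁.not_coGem hxb.symm hxa hya.symm (hS b hb a ha) (fun h => hyb h.symm) hxy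
      (hS b hb s hs) hxs (hS a ha s hs) hys

/-- Adjacent vertices missing a common vertex of an independent set `S` have equal traces on `S`
as soon as both traces are nonempty. -/
lemma trace_subset_of_adj (h₁ : IsIndFree coGem G) (h₂ : IsIndFree pawPlusPoint G)
    {S : Finset V} (hS : ∀ a ∈ S, ∀ b ∈ S, ¬ G.Adj a b) {x y s a b : V}
    (hs : s ∈ S) (ha : a ∈ S) (hb : b ∈ S) (hxs : ¬ G.Adj x s) (hys : ¬ G.Adj y s)
    (hxy : G.Adj x y) (hxa : G.Adj x a) (hyb : G.Adj y b) : G.Adj y a := by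
  by_contra hya
  by_cases hxb : G.Adj x b
  · exact hya (trace_subset_of_common h₁ h₂ hS hs hb ha hxs hys hxb hyb hxa)
  · exact h₁.not_coGem hxa.symm hxy hyb (fun h => hya h.symm) (hS a ha b hb) hxb
      (hS a ha s hs) hxs hys (hS b hb s hs)

end ForbiddenPatterns

/-! ### Recolouring arguments in vertex-critical graphs. -/

section Criticality

variable {V : Type*} {G : SimpleGraph V} {k : ℕ}

lemma IsVertexCritical.colorable (h : IsVertexCritical G k) : G.Colorable k :=
  SimpleGraph.chromaticNumber_le_iff_colorable.1 h.1.le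

lemma IsVertexCritical.not_coloring (h : IsVertexCritical G k) {m : ℕ} (hm : m < k)
    (c : V → ℕ) (hc : ∀ v, c v < m) : ∃ u v, G.Adj u v ∧ c u = c v := by
  by_contra! hne
  have hcol : G.Colorable m :=
    ⟨SimpleGraph.Coloring.mk (fun v => (⟨c v, hc v⟩ : Fin m)) fun {u v} huv heq =>
      hne u v huv (congrArg Fin.val heq)⟩
  have := SimpleGraph.chromaticNumber_le_iff_colorable.2 hcol
  rw [h.1] at this
  exact absurd (by exact_mod_cast this) (not_le.2 hm)

/-- Total functions to `ℕ`, with a junk value at `v`, let later arguments recolour by `if`. -/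
lemma IsVertexCritical.exists_coloring (h : IsVertexCritical G k) (v : V) :
    ∃ c : V → ℕ, (∀ u, u ≠ v → c u < k - 1) ∧
      ∀ u w, u ≠ v → w ≠ v → G.Adj u w → c u ≠ c w := by
  classical
  have hcol : (G.induce ({v}ᶜ : Set V)).Colorable (k - 1) := by
    apply SimpleGraph.chromaticNumber_le_iff_colorable.1
    have hlt := h.2 v
    have hk : k ≠ 0 := by rintro rfl; simp at hlt
    obtain ⟨m, rfl⟩ := Nat.exists_eq_succ_of_ne_zero hk
    exact Order.le_of_lt_add_one (by simpa using hlt)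
  obtain ⟨c⟩ := hcol
  refine ⟨fun u => if hu : u = v then 0 else c ⟨u, hu⟩, fun u hu => ?_, fun u w hu hw huw => ?_⟩
  · simp [hu]
  · simp only [hu, hw, dite_false, ne_eq]
    intro heq
    exact c.valid (v := ⟨u, hu⟩) (w := ⟨w, hw⟩) huw (Fin.ext heq)

lemma IsVertexCritical.pos (h : IsVertexCritical G k) (v : V) : k - 1 < k := by
  have hlt := h.2 v
  have hk : k ≠ 0 := by rintro rfl; simp at hlt
  omega

/-- A vertex-critical graph has no comparable vertices. -/
lemma IsVertexCritical.exists_adj_not_adj (h : IsVertexCritical G k) {s t : V} (hst : s ≠ t) :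
    ∃ x, G.Adj x s ∧ ¬ G.Adj x t := by
  classical
  by_contra! hsub
  obtain ⟨c, hlt, hc⟩ := h.exists_coloring s
  obtain ⟨u, w, huw, heq⟩ := h.not_coloring (h.pos s) (fun v => if v = s then c t else c v)
    (fun v => by split_ifs with hv; exacts [hlt t hst.symm, hlt v hv])
  by_cases hu : u = s <;> by_cases hw : w = s <;> simp only [hu, hw, if_true, if_false] at heq
  · exact G.irrefl (hw ▸ hu ▸ huw)
  · exact hc w t hw hst.symm (hsub w (hu ▸ huw.symm)) heq.symm
  · exact hc u t hu hst.symm (hsub u (hw ▸ huw)) heq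
  · exact hc u w hu hw huw heq

/-- If every vertex outside the independent set `S` misses at most one vertex of `S`, then `S` has
at most `k` vertices. -/
lemma IsVertexCritical.card_le_of_misses_le_one (h : IsVertexCritical G k) {S : Finset V}
    (hS : ∀ a ∈ S, ∀ b ∈ S, ¬ G.Adj a b)
    (hmiss : ∀ y ∉ S, ∀ a ∈ S, ∀ b ∈ S, a ≠ b → G.Adj y a ∨ G.Adj y b) : S.card ≤ k := by
  classical
  by_contra! hcard
  obtain ⟨v, hv⟩ : S.Nonempty := Finset.card_pos.1 (by omega)
  obtain ⟨c, hlt, hc⟩ := h.exists_coloring v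
  have hpos := h.pos v
  -- At least `k` vertices share `k - 1` colours. The repeated colour is free for `v`: a vertex
  -- outside `S` is adjacent to `a` or `b`, so does not carry it.
  obtain ⟨a, ha, b, hb, hab, hcab⟩ := Finset.exists_ne_map_eq_of_card_lt_of_maps_to
    (s := S.erase v) (t := Finset.range (k - 1)) (f := c)
    (by rw [Finset.card_range, Finset.card_erase_of_mem hv]; omega)
    (fun u hu => by simpa using hlt u (Finset.ne_of_mem_erase hu))
  rw [Finset.mem_erase] at ha hb
  have key : ∀ u, u ≠ v → G.Adj u v → c u ≠ c a := by
    intro u hu huv heq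
    have huS : u ∉ S := fun huS => hS u huS v hv huv
    rcases hmiss u huS a ha.2 b hb.2 hab with hua | hub
    · exact hc u a hu ha.1 hua heq
    · exact hc u b hu hb.1 hub (heq.trans hcab)
  obtain ⟨u, w, huw, heq⟩ := h.not_coloring hpos (fun u => if u = v then c a else c u)
    (fun u => by split_ifs with hu; exacts [hlt a ha.1, hlt u hu])
  by_cases hu : u = v <;> by_cases hw : w = v <;> simp only [hu, hw, if_true, if_false] at heq
  · exact G.irrefl (hw ▸ hu ▸ huw)
  · exact key w hw (hu ▸ huw.symm) heq.symm
  · exact key u hu (hw ▸ huw) heq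
  · exact hc u w hu hw huw heq

/-- Sets `A`, `B` of vertices of a vertex-critical graph cannot both be unions of components of
`G - F` and be complete to `F`. -/
lemma IsVertexCritical.not_complete_to_separator [Finite V] (h : IsVertexCritical G k)
    {A B F : Set V} {s t : V} (hs : s ∈ A) (ht : t ∈ B) (hsB : s ∉ B) (htA : t ∉ A)
    (hsF : s ∉ F) (htF : t ∉ F)
    (hAF : ∀ a ∈ A, ∀ f ∈ F, G.Adj a f) (hBF : ∀ b ∈ B, ∀ f ∈ F, G.Adj b f)
    (hA : ∀ a ∈ A, ∀ v ∉ A, G.Adj a v → v ∈ F) (hB : ∀ b ∈ B, ∀ v ∉ B, G.Adj b v → v ∈ F) :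
    False := by
  classical
  have := Fintype.ofFinite V
  obtain ⟨c, hclt, hc⟩ := h.exists_coloring s
  obtain ⟨d, hdlt, hd⟩ := h.exists_coloring t
  -- The colours unused on `F`, the only ones available to sets complete to `F`.
  set P : (V → ℕ) → Finset ℕ := fun c =>
    Finset.range (k - 1) \ (Finset.univ.filter (· ∈ F)).image c with hP
  -- Keep `c` off `A`, and on `A` use `d` with its colours injected into those that `c` leaves free
  -- on `F`. This also colours `s`.
  have recolor : ∀ {A : Set V} {s t : V} {c d : V → ℕ}, s ∈ A → t ∉ A → s ∉ F → t ∉ F →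
      (∀ a ∈ A, ∀ f ∈ F, G.Adj a f) → (∀ a ∈ A, ∀ v ∉ A, G.Adj a v → v ∈ F) →
      (∀ u, u ≠ s → c u < k - 1) → (∀ u w, u ≠ s → w ≠ s → G.Adj u w → c u ≠ c w) →
      (∀ u, u ≠ t → d u < k - 1) → (∀ u w, u ≠ t → w ≠ t → G.Adj u w → d u ≠ d w) →
      (P d).card ≤ (P c).card → False := by
    intro A s t c d hs htA hsF htF hAF hA hclt hc hdlt hd hcard
    obtain ⟨e, hmaps, hinj⟩ : ∃ e : ℕ → ℕ, (∀ i ∈ P d, e i ∈ P c) ∧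
        ∀ i ∈ P d, ∀ j ∈ P d, e i = e j → i = j := by
      obtain ⟨e⟩ : Nonempty (P d ↪ P c) := by
        apply Function.Embedding.nonempty_of_card_le
        simpa using hcard
      refine ⟨fun i => if hi : i ∈ P d then e ⟨i, hi⟩ else 0, fun i hi => ?_,
        fun i hi j hj hij => ?_⟩
      · simp only [hi, dite_true]
        exact (e ⟨i, hi⟩).2
      · simp only [hi, hj, dite_true] at hij
        exact congrArg Subtype.val (e.injective (Subtype.ext hij))
    have hdP : ∀ a ∈ A, d a ∈ P d := by
      intro a ha
      have hat : a ≠ t := fun h => htA (h ▸ ha)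
      simp only [hP, Finset.mem_sdiff, Finset.mem_range, Finset.mem_image, Finset.mem_filter,
        Finset.mem_univ, true_and, not_exists, not_and]
      exact ⟨hdlt a hat, fun f hf heq =>
        hd a f hat (fun h => htF (h ▸ hf)) (hAF a ha f hf) heq.symm⟩
    have hcP : ∀ i ∈ P c, i < k - 1 ∧ ∀ f ∈ F, c f ≠ i := by
      intro i hi
      simpa [hP] using hi
    obtain ⟨u, w, huw, heq⟩ := h.not_coloring (h.pos s) (fun u => if u ∈ A then e (d u) else c u)
      (fun u => by
        split_ifs with hu
        · exact (hcP _ (hmaps _ (hdP u hu))).1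
        · exact hclt u (fun h => hu (h ▸ hs)))
    by_cases hu : u ∈ A <;> by_cases hw : w ∈ A <;>
      simp only [hu, hw, if_true, if_false] at heq
    · exact hd u w (fun h => htA (h ▸ hu)) (fun h => htA (h ▸ hw)) huw
        (hinj _ (hdP u hu) _ (hdP w hw) heq)
    · exact (hcP _ (hmaps _ (hdP u hu))).2 w (hA u hu w hw huw) heq.symm
    · exact (hcP _ (hmaps _ (hdP w hw))).2 u (hA w hw u hu huw.symm) heq
    · exact hc u w (fun h => hu (h ▸ hs)) (fun h => hw (h ▸ hs)) huw heq
  rcases le_total (P d).card (P c).card with hle | hle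
  · exact recolor hs htA hsF htF hAF hA hclt hc hdlt hd hle
  · exact recolor ht hsB htF hsF hBF hB hdlt hd hclt hc hle

end Criticality

/-! ### Bounding independent sets, hence the order. -/

section IndependentSets

variable {V : Type*} {G : SimpleGraph V} {k : ℕ}

/-- If a vertex outside a maximal independent set `S` misses two vertices of `S`, then every vertex
outside `S` is complete to `S` or has exactly one neighbour in `S`. -/
lemma IsVertexCritical.trace_eq_of_misses_two (h : IsVertexCritical G k)
    (h₁ : IsIndFree coGem G) (h₂ : IsIndFree pawPlusPoint G) {S : Finset V}
    (hS : ∀ a ∈ S, ∀ b ∈ S, ¬ G.Adj a b) (hmax : ∀ x ∉ S, ∃ a ∈ S, G.Adj x a)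
    {y s t : V} (hy : y ∉ S) (hs : s ∈ S) (ht : t ∈ S) (hst : s ≠ t)
    (hys : ¬ G.Adj y s) (hyt : ¬ G.Adj y t) {z a b r : V} (ha : a ∈ S) (hb : b ∈ S) (hr : r ∈ S)
    (hza : G.Adj z a) (hzb : G.Adj z b) (hzr : ¬ G.Adj z r) : a = b := by
  have trace {x y r a b : V} := trace_subset_of_common h₁ h₂ hS (x := x) (y := y) (s := r)
    (a := a) (b := b)
  -- An incomplete trace that meets the trace of `y` equals it.
  have meets : ∀ z r a, r ∈ S → a ∈ S → ¬ G.Adj z r → G.Adj z a → G.Adj y a →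
      ∀ b ∈ S, G.Adj z b ↔ G.Adj y b := by
    intro z r a hr ha hzr hza hya
    by_cases hzs : G.Adj z s
    · exfalso
      by_cases hzt : G.Adj z t
      · obtain ⟨x, hxs, hxt⟩ := h.exists_adj_not_adj hst
        by_cases hyr : G.Adj y r
        · by_cases hxr : G.Adj x r
          · exact hys (trace ht hr hs hxt hyt hxr hyr hxs)
          · exact hxt (trace hr hs ht hzr hxr hzs hxs hzt)
        · exact hys (trace hr ha hs hzr hyr hza hya hzs)
      · exact hys (trace ht ha hs hzt hyt hza hya hzs)
    · exact fun b hb => ⟨fun hzb => trace hs ha hb hzs hys hza hya hzb,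
        fun hyb => trace hs ha hb hys hzs hya hza hyb⟩
  by_contra hab
  obtain ⟨w, hwa, hwb⟩ := h.exists_adj_not_adj hab
  by_cases hwr : G.Adj w r
  · obtain ⟨q, hq, hyq⟩ := hmax y hy
    by_cases hya : G.Adj y a
    · exact hwb ((meets w b a hb ha hwb hwa hya b hb).2
        ((meets z r a hr ha hzr hza hya b hb).1 hzb))
    -- If `z` or `w` were adjacent to `q`, its trace would be that of `y`, which omits `a`. So both
    -- miss `q` and can be compared.
    · by_cases hzq : G.Adj z q
      · exact hya ((meets z r q hr hq hzr hzq hyq a ha).1 hza)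
      · by_cases hwq : G.Adj w q
        · exact hya ((meets w b q hb hq hwb hwq hyq a ha).1 hwa)
        · exact hwb (trace hq ha hb hzq hwq hza hwa hzb)
  · exact hwb (trace hr ha hb hzr hwr hza hwa hzb)

/-- Maximal independent sets of a `k`-vertex-critical (co-gem, paw + `P₁`)-free graph have at most
`max k 2` vertices. -/
lemma IsVertexCritical.card_maximal_indep_le [Finite V] (h : IsVertexCritical G k)
    (h₁ : IsIndFree coGem G) (h₂ : IsIndFree pawPlusPoint G) {S : Finset V}
    (hS : ∀ a ∈ S, ∀ b ∈ S, ¬ G.Adj a b) (hmax : ∀ x ∉ S, ∃ a ∈ S, G.Adj x a) :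
    S.card ≤ max k 2 := by
  classical
  by_contra! hcard
  rw [max_lt_iff] at hcard
  by_cases hmiss : ∀ y ∉ S, ∀ a ∈ S, ∀ b ∈ S, a ≠ b → G.Adj y a ∨ G.Adj y b
  · exact absurd (h.card_le_of_misses_le_one hS hmiss) (not_le.2 hcard.1)
  push Not at hmiss
  obtain ⟨y, hy, s', hs', t', ht', hst', hys, hyt⟩ := hmiss
  have single {z a b r : V} := h.trace_eq_of_misses_two h₁ h₂ hS hmax hy hs' ht' hst' hys hyt
    (z := z) (a := a) (b := b) (r := r)
  -- The `2` in `max k 2` is needed here.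
  have third : ∀ s ∈ S, ∀ t ∈ S, ∃ r ∈ S, r ≠ s ∧ r ≠ t := by
    intro s _ t _
    obtain ⟨r, hr, hrst⟩ := Finset.exists_mem_notMem_of_card_lt_card
      (s := {s, t}) (t := S) (lt_of_le_of_lt Finset.card_le_two hcard.2)
    simp only [Finset.mem_insert, Finset.mem_singleton, not_or] at hrst
    exact ⟨r, hr, hrst.1, hrst.2⟩
  have anti : ∀ s ∈ S, ∀ t ∈ S, s ≠ t → ∀ x x', (∃ r ∈ S, ¬ G.Adj x r) → (∃ r ∈ S, ¬ G.Adj x' r) →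
      G.Adj x s → G.Adj x' t → ¬ G.Adj x x' := by
    rintro s hs t ht hst x x' ⟨p, hp, hxp⟩ ⟨q, hq, hxq⟩ hxs hxt hadj
    obtain ⟨r, hr, hrs, hrt⟩ := third s hs t ht
    have hxr : ¬ G.Adj x r := fun hxr => hrs (single hr hs hp hxr hxs hxp)
    have hxr' : ¬ G.Adj x' r := fun hxr => hrt (single hr ht hq hxr hxt hxq)
    exact hst (single hs ht hq
      (trace_subset_of_adj h₁ h₂ hS hr hs ht hxr hxr' hadj hxs hxt) hxt hxq)
  have full : ∀ s ∈ S, ∀ x, (∃ r ∈ S, ¬ G.Adj x r) → G.Adj x s →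
      ∀ f, (∀ r ∈ S, G.Adj f r) → G.Adj x f := by
    rintro s hs x ⟨p, hp, hxp⟩ hxs f hf
    by_contra hxf
    have only : ∀ r ∈ S, r ≠ s → ¬ G.Adj x r :=
      fun r hr hrs hxr => hrs (single hr hs hp hxr hxs hxp)
    obtain ⟨t, ht, hts, -⟩ := third s hs s hs
    obtain ⟨r, hr, hrs, hrt⟩ := third s hs t ht
    -- `w` is a private neighbour of `t`. Either `w, t, f, r` is a paw missed by `x`, or `x, s, f,
    -- r` is an induced path missed by `w`.
    obtain ⟨w, hwt, hwr⟩ := h.exists_adj_not_adj hrt.symm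
    have hws : ¬ G.Adj w s := fun hws => hts (single ht hs hr hwt hws hwr)
    have hxw : ¬ G.Adj x w := anti s hs t ht hts.symm x w ⟨p, hp, hxp⟩ ⟨r, hr, hwr⟩ hxs hwt
    by_cases hwf : G.Adj w f
    · exact h₂.not_pawPlusPoint hwt (hf t ht).symm hwf (hf r hr) hwr (hS t ht r hr)
        (fun h => hxw h.symm) (fun h => only t ht hts h.symm) (fun h => hxf h.symm)
        (fun h => only r hr hrs h.symm)
    · exact h₁.not_coGem hxs (hf s hs).symm (hf r hr) hxf (only r hr hrs) (hS s hs r hr)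
        hxw (fun h => hws h.symm) (fun h => hwf h.symm) (fun h => hwr h.symm)
  obtain ⟨s, hs⟩ : S.Nonempty := Finset.card_pos.1 (by omega)
  obtain ⟨t, ht, hts, -⟩ := third s hs s hs
  -- `C s` consists of `s` and its private neighbours, a union of components of `G - F`.
  let F : Set V := {f | ∀ r ∈ S, G.Adj f r}
  let C : V → Set V := fun s => {x | (∃ r ∈ S, ¬ G.Adj x r) ∧ (x = s ∨ G.Adj x s)}
  have hF : ∀ s ∈ S, s ∉ F := fun s hs hf => G.irrefl (hf s hs)
  have hself : ∀ s ∈ S, s ∈ C s := fun s hs => ⟨⟨s, hs, G.irrefl⟩, Or.inl rfl⟩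
  have hne : ∀ s ∈ S, ∀ t ∈ S, s ≠ t → s ∉ C t := by
    rintro s hs t ht hst ⟨-, h | h⟩
    exacts [hst h, hS s hs t ht h]
  have hCF : ∀ s ∈ S, ∀ x ∈ C s, ∀ f ∈ F, G.Adj x f := by
    rintro s hs x ⟨hx, rfl | hxs⟩ f hf
    exacts [(hf x hs).symm, full s hs x hx hxs f hf]
  have hC : ∀ s ∈ S, ∀ x ∈ C s, ∀ v ∉ C s, G.Adj x v → v ∈ F := by
    rintro s hs x ⟨hx, hxs⟩ v hv hxv
    by_contra hvF
    have hvF' : ∃ r ∈ S, ¬ G.Adj v r := by simpa [F] using hvF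
    rcases hxs with rfl | hxs
    · exact hv ⟨hvF', Or.inr hxv.symm⟩
    · by_cases hvS : v ∈ S
      · obtain ⟨p, hp, hxp⟩ := hx
        exact hv ⟨hvF', Or.inl (single hvS hs hp hxv hxs hxp)⟩
      · obtain ⟨q, hq, hvq⟩ := hmax v hvS
        refine anti s hs q hq ?_ x v hx hvF' hxs hvq hxv
        rintro rfl
        exact hv ⟨hvF', Or.inr hvq⟩
  exact h.not_complete_to_separator (hself s hs) (hself t ht) (hne s hs t ht hts.symm)
    (hne t ht s hs hts) (hF s hs) (hF t ht) (hCF s hs) (hCF t ht) (hC s hs) (hC t ht)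

lemma IsVertexCritical.card_indep_le [Finite V] (h : IsVertexCritical G k)
    (h₁ : IsIndFree coGem G) (h₂ : IsIndFree pawPlusPoint G) {S : Finset V}
    (hS : ∀ a ∈ S, ∀ b ∈ S, ¬ G.Adj a b) : S.card ≤ max k 2 := by
  classical
  have := Fintype.ofFinite V
  obtain ⟨T, hST, hT⟩ := (Set.toFinite
    {S : Finset V | ∀ a ∈ S, ∀ b ∈ S, ¬ G.Adj a b}).exists_le_maximal (a := S) hS
  refine (Finset.card_le_card hST).trans (h.card_maximal_indep_le h₁ h₂ hT.prop fun x hx => ?_)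
  by_contra! hno
  refine hx (hT.le_of_ge (y := insert x T) ?_ (Finset.subset_insert x T)
    (Finset.mem_insert_self x T))
  intro a ha b hb
  rw [Finset.mem_insert] at ha hb
  rcases ha with rfl | ha <;> rcases hb with rfl | hb
  · exact G.irrefl
  · exact hno b hb
  · exact fun h => hno a ha h.symm
  · exact hT.prop a ha b hb

lemma IsVertexCritical.card_le [Finite V] (h : IsVertexCritical G k)
    (h₁ : IsIndFree coGem G) (h₂ : IsIndFree pawPlusPoint G) : Nat.card V ≤ max k 2 * k := by
  classical
  have := Fintype.ofFinite V
  obtain ⟨c⟩ := h.colorable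
  rw [Nat.card_eq_fintype_card, ← Finset.card_univ]
  simpa using Finset.card_le_mul_card_image_of_maps_to (s := Finset.univ)
    (t := (Finset.univ : Finset (Fin k))) (f := c) (fun _ _ => Finset.mem_univ _) (max k 2)
    (fun i _ => h.card_indep_le h₁ h₂ fun a ha b hb hab => by
      simp only [Finset.mem_filter] at ha hb
      exact c.valid hab (ha.2.trans hb.2.symm))

end IndependentSets

theorem theorem4p1 (k : ℕ) :
    ∃ L : Finset (Σ n : ℕ, SimpleGraph (Fin n)),
      ∀ (V : Type*) [Finite V] (G : SimpleGraph V),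
        IsVertexCritical G k → IsIndFree coGem G → IsIndFree pawPlusPoint G →
          ∃ F ∈ L, Nonempty (G ≃g F.2) := by
  classical
  refine ⟨(Finset.range (max k 2 * k + 1)).sigma fun _ => Finset.univ, fun V _ G h h₁ h₂ => ?_⟩
  let e := Finite.equivFin V
  refine ⟨⟨Nat.card V, G.map e.toEmbedding⟩, ?_, ⟨SimpleGraph.Iso.map e G⟩⟩
  simpa [Nat.lt_succ_iff] using h.card_le h₁ h₂
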